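/- \textbf{Theorem (Bayesian error exponent).} Let $\mathcal X=\{0,\dots,d-1\}$, let $M_1(\mathcal X)\subset\mathbb R^d$ be the set of probability distributions on $\mathcal X$ with the Euclidean topology, and let $p\in M_1(\mathcal X)$, $Q\subseteq M_1(\mathcal X)$, $c:Q\to[0,\infty)$ and $\gamma>0$. For $n\ge1$ and $\mathbf x=(x_1,\dots,x_n)\in\mathcal X^n$ write $q(\mathbf x)=\prod_{k}q(x_k)$. In the game $\mathcal G^B(d,n)$ the attacker chooses $q\in Q$, the defender chooses a randomized decision rule $\varphi\in\Phi_n=\{\varphi:\mathcal X^n\to[0,1]\}$, and their utilities are $$u_n^A(q,\varphi)=\sum_{\mathbf x}(1-\varphi(\mathbf x))q(\mathbf x)-c(q),\qquad u_n^D(q,\varphi)=-\Big(\sum_{\mathbf x}(1-\varphi(\mathbf x))q(\mathbf x)+\gamma\sum_{\mathbf x}\varphi(\mathbf x)p(\mathbf x)\Big).$$ Mixed strategies are Borel probability measures $\sigma^A$ on $Q$ and $\sigma^D$ on $\Phi_n$ (with the sup metric); functions of $(q,\varphi)$ are extended to mixed strategies by integrating against $\sigma^A\otimes\sigma^D$.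 A mixed Nash equilibrium is a pair from which neither player can increase their own utility by changing only their own mixed strategy. The classification error is $e_n=-u_n^D$. Assume: \begin{itemize} \item[(A1)] $Q$ is closed and $p\notin Q$. \item[(A2)] $p(i)>0$ for all $i\in\mathcal X$, and $q(i)>0$ for all $q\in Q$, $i\in\mathcal X$. \item[(A3)] $c$ is continuous on $Q$ and has a unique minimizer $q^*\in Q$. \item[(A4)] $\{\mu\in M_1(\mathcal X): D(\mu\|p)\le D(\mu\|q^*)\}\cap Q=\emptyset$, where $D(\mu\|\nu)=\sum_{i}\mu(i)\log\frac{\mu(i)}{\nu(i)}$ (with $0\log 0=0$). \end{itemize} Let $$\Lambda_0(\lambda)=\log\sum_{i\in\mathcal X}\exp\Big(\lambda\log\frac{q^*(i)}{p(i)}\Big)p(i)\quad(\lambda\in\mathbb R),\qquad \Lambda_0^*(x)=\sup_{\lambda\in\mathbb R}\{\lambda x-\Lambda_0(\lambda)\}.$$ Let $(\hat\sigma_n^A,\hat\sigma_n^D)_{n\ge1}$ be any sequence such that, for each $n\ge1$, $(\hat\sigma_n^A,\hat\sigma_n^D)$ is a mixed Nash equilibrium of $\mathcal G^B(d,n)$.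 Then $$\lim_{n\to\infty}\frac1n\log e_n(\hat\sigma_n^A,\hat\sigma_n^D)=-\Lambda_0^*(0),$$ and $\Lambda_0^*(0)$ is the Chernoff information of $p$ and $q^*$, i.e. $\Lambda_0^*(0)=\max_{0\le\lambda\le1}\big(-\log\sum_{i}p(i)^{1-\lambda}q^*(i)^{\lambda}\big)$. -/

import Mathlib

open MeasureTheory Filter Topology
open scoped NNReal

noncomputable section

namespace AdvTest

/-- `M₁(𝒳)` for the alphabet `𝒳 = Fin d`, with the topology (and Borel sets) inherited from `ℝ^d`. -/
abbrev Dist (d : ℕ) : Type := stdSimplex ℝ (Fin d)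

/-- `Φ_n`: randomized decision rules; `φ x` is the probability of declaring an attack on seeing `x`.
It carries the product topology and its Borel sets. -/
abbrev DecisionRule (d n : ℕ) : Type := (Fin n → Fin d) → unitInterval

/-- Probability of the word `x` when its letters are drawn independently from `q`. -/
def wordProb {d n : ℕ} (q : Dist d) (x : Fin n → Fin d) : ℝ := ∏ k, q.1 (x k)

/-- Missed-detection probability `∑ₓ (1 - φ(x)) q(x)`. -/
def missProb {d n : ℕ} (q : Dist d) (φ : DecisionRule d n) : ℝ :=
  ∑ x : Fin n → Fin d, (1 - (φ x : ℝ)) * wordProb q x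

/-- False-alarm probability `∑ₓ φ(x) p(x)`. -/
def falseAlarmProb {d n : ℕ} (p : Dist d) (φ : DecisionRule d n) : ℝ :=
  ∑ x : Fin n → Fin d, (φ x : ℝ) * wordProb p x

/-- Utility `u_n^A` of the attacker under pure strategies. -/
def attackerUtility {d : ℕ} (Q : Set (Dist d)) (c : Q → ℝ≥0) (n : ℕ)
    (q : Q) (φ : DecisionRule d n) : ℝ :=
  missProb q.1 φ - (c q : ℝ)

/-- Utility `u_n^D` of the defender under pure strategies. -/
def defenderUtility {d : ℕ} (p : Dist d) (Q : Set (Dist d)) (γ : ℝ) (n : ℕ)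
    (q : Q) (φ : DecisionRule d n) : ℝ :=
  -(missProb q.1 φ + γ * falseAlarmProb p φ)

/-- Classification error `e_n = -u_n^D`. -/
def classError {d : ℕ} (p : Dist d) (Q : Set (Dist d)) (γ : ℝ) (n : ℕ)
    (q : Q) (φ : DecisionRule d n) : ℝ :=
  -defenderUtility p Q γ n q φ

/-- Extension of a function of two pure strategies to independent mixed strategies. -/
def mixedExt {S T : Type} [MeasurableSpace S] [MeasurableSpace T] (u : S → T → ℝ)
    (σ : ProbabilityMeasure S) (τ : ProbabilityMeasure T) : ℝ :=
  ∫ z : S × T, u z.1 z.2 ∂((σ : Measure S).prod (τ : Measure T))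

/-- `(σ, τ)` is a mixed Nash equilibrium of the two-player game in which player 1 has pure
strategies `S` and utility `u₁`, and player 2 has pure strategies `T` and utility `u₂`. -/
def IsMixedNash {S T : Type} [MeasurableSpace S] [MeasurableSpace T] (u₁ u₂ : S → T → ℝ)
    (σ : ProbabilityMeasure S) (τ : ProbabilityMeasure T) : Prop :=
  (∀ σ' : ProbabilityMeasure S, mixedExt u₁ σ' τ ≤ mixedExt u₁ σ τ) ∧
  (∀ τ' : ProbabilityMeasure T, mixedExt u₂ σ τ' ≤ mixedExt u₂ σ τ)

/-- Relative entropy `D(μ‖ν)`, for `ν` with full support; `0 * log 0 = 0` holds in Lean. -/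
def relEntropy {d : ℕ} (μ ν : Dist d) : ℝ := ∑ i, μ.1 i * Real.log (μ.1 i / ν.1 i)

/-- Log-moment generating function, under `p`, of the log-likelihood ratio `log (q(X) / p(X))`. -/
def logMGF {d : ℕ} (p q : Dist d) (t : ℝ) : ℝ :=
  Real.log (∑ i, Real.exp (t * Real.log (q.1 i / p.1 i)) * p.1 i)

/-- Fenchel-Legendre transform, with values in the extended reals. -/
def fenchelLegendre (Λ : ℝ → ℝ) (x : ℝ) : EReal := ⨆ t : ℝ, ((t * x - Λ t : ℝ) : EReal)

/-- Chernoff information of `p` and `q`: `max_{0 ≤ t ≤ 1} -log ∑ᵢ p(i)^{1-t} q(i)^t`. -/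
def chernoffInformation {d : ℕ} (p q : Dist d) : ℝ :=
  ⨆ t : unitInterval, -Real.log (∑ i, p.1 i ^ (1 - (t : ℝ)) * q.1 i ^ (t : ℝ))

end AdvTest

end

/-! Write `f` for the minimum over `t` of `ratioMGF p q* t`. Convexity and the value 1 at 0 and 1
place a minimizer in `[0, 1]`, so `-log f` is both the transform at 0 and the Chernoff information.
It remains to show that the equilibrium error `E` decays like `f ^ n`.

Lower bound: the players' payoffs share the missed-detection term, so the attacker's option to
deviate to `q*` gives `E ≥ C + (Bayes error of p against q*)`, with `C ≥ 0` the expected excess cost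
over `c(q*)` (`le_classError_of_isMixedNash`). Exponential tilting bounds the Bayes error below
(`eventually_le_sum_min_wordProb`).

Upper bound: let the defender deviate to the likelihood ratio test of `p` against `q*`. False
alarms, and misses for `q` near `q*`, are at most `a ^ n` with `a` slightly above `f`. For `q` away
from `q*`, (A4) and compactness give only a miss bound `ρ ^ n` with `ρ < 1`, possibly larger than `f
^ n`; but such `q` cost at least `η` extra. Hence `E ≤ (1 + γ) a ^ n + (ρ ^ n / η) C`, and `C ≤ E`
lets the last term be absorbed. -/

namespace AdvTest

/-! ### Exponential moments and concentration for i.i.d. words -/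

section WordSums

variable {ι : Type*} [Fintype ι]

lemma sum_words_prod_mul_exp (n : ℕ) (r g : ι → ℝ) (s : ℝ) :
    ∑ x : Fin n → ι, (∏ k, r (x k)) * Real.exp (s * ∑ k, g (x k)) =
      (∑ i, r i * Real.exp (s * g i)) ^ n := by
  rw [Fintype.sum_pow]
  refine Finset.sum_congr rfl fun x _ => ?_
  rw [Finset.mul_sum, Real.exp_sum, Finset.prod_mul_distrib]

/-- Chernoff's bound for the lower tail of a sum of i.i.d. letters. -/
lemma sum_words_le_pow (n : ℕ) {r : ι → ℝ} (hr : ∀ i, 0 ≤ r i) (g : ι → ℝ) {s : ℝ}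
    {w : (Fin n → ι) → ℝ} (hw : ∀ x, w x ≤ Real.exp (s * ∑ k, g (x k))) :
    ∑ x : Fin n → ι, w x * ∏ k, r (x k) ≤ (∑ i, r i * Real.exp (s * g i)) ^ n := by
  rw [← sum_words_prod_mul_exp]
  refine Finset.sum_le_sum fun x _ => ?_
  rw [mul_comm]
  exact mul_le_mul_of_nonneg_left (hw x) (Finset.prod_nonneg fun k _ => hr _)

/-- A uniform bound `< 1` on `E_r exp(-s g)` over all distributions `r` with `E_r g ≥ m > 0`. -/
lemma exists_sum_mul_exp_le (g : ι → ℝ) {m : ℝ} (hm : 0 < m) :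
    ∃ s > 0, ∃ ρ, 0 < ρ ∧ ρ < 1 ∧ ∀ r ∈ stdSimplex ℝ ι, m ≤ ∑ i, r i * g i →
      ∑ i, r i * Real.exp (-s * g i) ≤ ρ := by
  set B : ℝ := 1 + ∑ i, |g i| with hB
  have hB1 : 1 ≤ B := by
    rw [hB]; linarith [Finset.sum_nonneg fun i (_ : i ∈ Finset.univ) => abs_nonneg (g i)]
  have hgB : ∀ i, |g i| ≤ B := fun i => by
    have := Finset.single_le_sum (f := fun i => |g i|) (fun i _ => abs_nonneg (g i))
      (Finset.mem_univ i)
    linarith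
  have hB0 : 0 < B := by linarith
  -- The first bound keeps `|s g| ≤ 1`, where `exp y ≤ 1 + y + y ^ 2`; the second makes the
  -- quadratic term at most half of the linear gain `s m`.
  set s : ℝ := min (1 / B) (m / (2 * B ^ 2)) with hs
  have hs0 : 0 < s := lt_min (by positivity) (by positivity)
  have hs1 : s * B ≤ 1 := by
    have := min_le_left (1 / B) (m / (2 * B ^ 2))
    rwa [← hs, le_div_iff₀ hB0] at this
  have hs2 : s * (2 * B ^ 2) ≤ m := by
    have := min_le_right (1 / B) (m / (2 * B ^ 2))
    rwa [← hs, le_div_iff₀ (by positivity)] at this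
  refine ⟨s, hs0, Real.exp (-(s * m / 2)), Real.exp_pos _, ?_, fun r hr hrm => ?_⟩
  · rw [Real.exp_lt_one_iff]
    have := mul_pos hs0 hm
    linarith
  have key : ∀ i, r i * Real.exp (-s * g i) ≤ r i * (1 + s ^ 2 * B ^ 2) - s * (r i * g i) := by
    intro i
    have habs : |-s * g i| ≤ s * B := by
      rw [abs_mul, abs_neg, abs_of_pos hs0]
      exact mul_le_mul_of_nonneg_left (hgB i) hs0.le
    have h1 := (abs_le.1 (Real.abs_exp_sub_one_sub_id_le (habs.trans hs1))).2
    have h2 : (-s * g i) ^ 2 ≤ (s * B) ^ 2 := sq_le_sq' (abs_le.1 habs).1 (abs_le.1 habs).2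
    have h3 : Real.exp (-s * g i) ≤ 1 + s ^ 2 * B ^ 2 - s * g i := by nlinarith
    calc r i * Real.exp (-s * g i) ≤ r i * (1 + s ^ 2 * B ^ 2 - s * g i) :=
          mul_le_mul_of_nonneg_left h3 (hr.1 i)
      _ = _ := by ring
  calc ∑ i, r i * Real.exp (-s * g i)
      ≤ ∑ i, (r i * (1 + s ^ 2 * B ^ 2) - s * (r i * g i)) := Finset.sum_le_sum fun i _ => key i
    _ = 1 + s ^ 2 * B ^ 2 - s * ∑ i, r i * g i := by
        rw [Finset.sum_sub_distrib, ← Finset.sum_mul, hr.2, ← Finset.mul_sum, one_mul]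
    _ ≤ 1 - s * m / 2 := by nlinarith
    _ ≤ Real.exp (-(s * m / 2)) := by linarith [Real.add_one_le_exp (-(s * m / 2))]

/-- Weak law of large numbers for i.i.d. letters with mean `0`. -/
lemma eventually_half_le_sum_words {r g : ι → ℝ} (hr : r ∈ stdSimplex ℝ ι)
    (hg : ∑ i, r i * g i = 0) {ε : ℝ} (hε : 0 < ε) :
    ∀ᶠ n : ℕ in atTop, 1 / 2 ≤ ∑ x : Fin n → ι with |∑ k, g (x k)| ≤ n * ε, ∏ k, r (x k) := by
  have hmean : ∀ σ : ℝ, ε ≤ ∑ i, r i * (ε + σ * g i) := fun σ => by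
    have : ∑ i, r i * (ε + σ * g i) = (∑ i, r i) * ε + σ * ∑ i, r i * g i := by
      rw [Finset.sum_mul, Finset.mul_sum, ← Finset.sum_add_distrib]
      exact Finset.sum_congr rfl fun i _ => by ring
    rw [this, hg, hr.2]; linarith
  -- The letter function `ε + σ g` has mean `ε > 0`, and its sum is negative exactly on this tail;
  -- `σ = ±1` gives the two sides.
  have tail : ∀ σ : ℝ, ∃ ρ, 0 < ρ ∧ ρ < 1 ∧ ∀ n : ℕ,
      ∑ x : Fin n → ι, (if n * ε < -σ * ∑ k, g (x k) then (1 : ℝ) else 0) * ∏ k, r (x k)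
        ≤ ρ ^ n := by
    intro σ
    obtain ⟨s, hs, ρ, h0, h1, h⟩ := exists_sum_mul_exp_le (fun i => ε + σ * g i) hε
    refine ⟨ρ, h0, h1, fun n => ?_⟩
    refine (sum_words_le_pow n hr.1 (fun i => ε + σ * g i) (s := -s) fun x => ?_).trans
      (pow_le_pow_left₀ (Finset.sum_nonneg fun i _ => mul_nonneg (hr.1 i) (Real.exp_pos _).le)
        (h r hr (hmean σ)) n)
    split_ifs with hx
    · apply Real.one_le_exp
      have : ∑ k, (ε + σ * g (x k)) = n * ε + σ * ∑ k, g (x k) := by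
        simp [Finset.sum_add_distrib, Finset.mul_sum]
      rw [this]
      nlinarith
    · exact (Real.exp_pos _).le
  obtain ⟨ρ₁, h₁, h₁', H₁⟩ := tail 1
  obtain ⟨ρ₂, h₂, h₂', H₂⟩ := tail (-1)
  filter_upwards [(tendsto_pow_atTop_nhds_zero_of_lt_one h₁.le h₁').eventually
      (gt_mem_nhds (by norm_num : (0 : ℝ) < 1 / 4)),
    (tendsto_pow_atTop_nhds_zero_of_lt_one h₂.le h₂').eventually
      (gt_mem_nhds (by norm_num : (0 : ℝ) < 1 / 4))] with n hn₁ hn₂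
  have htot : ∑ x : Fin n → ι, ∏ k, r (x k) = 1 := by rw [← Fintype.sum_pow, hr.2, one_pow]
  have hsplit : ∑ x : Fin n → ι, ∏ k, r (x k) ≤
      ∑ x : Fin n → ι, ((if |∑ k, g (x k)| ≤ n * ε then ∏ k, r (x k) else 0) +
        (if n * ε < -1 * ∑ k, g (x k) then (1 : ℝ) else 0) * ∏ k, r (x k) +
        (if n * ε < -(-1) * ∑ k, g (x k) then (1 : ℝ) else 0) * ∏ k, r (x k)) := by
    refine Finset.sum_le_sum fun x _ => ?_
    have hpos : 0 ≤ ∏ k, r (x k) := Finset.prod_nonneg fun k _ => hr.1 _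
    by_cases ha : |∑ k, g (x k)| ≤ n * ε
    · rw [if_pos ha]; split_ifs <;> linarith
    · rw [if_neg ha]
      rw [not_le, lt_abs] at ha
      rcases ha with ha | ha
      · rw [if_pos (c := n * ε < -(-1) * ∑ k, g (x k)) (by linarith)]; split_ifs <;> linarith
      · rw [if_pos (c := n * ε < -1 * ∑ k, g (x k)) (by linarith)]; split_ifs <;> linarith
  rw [Finset.sum_add_distrib, Finset.sum_add_distrib, htot] at hsplit
  rw [Finset.sum_filter]
  linarith [H₁ n, H₂ n]

end WordSums

/-! ### Chernoff information and the lower bound on the Bayes error -/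

section Chernoff

variable {d : ℕ}

/-- Log-likelihood ratio `log (q(i) / p(i))` of a letter. -/
noncomputable def logRatio (p q : Dist d) (i : Fin d) : ℝ := Real.log (q.1 i / p.1 i)

/-- Moment generating function of the log-likelihood ratio under `p`. -/
noncomputable def ratioMGF (p q : Dist d) (t : ℝ) : ℝ := ∑ i, p.1 i * Real.exp (t * logRatio p q i)

lemma logMGF_eq (p q : Dist d) (t : ℝ) : logMGF p q t = Real.log (ratioMGF p q t) := by
  simp only [logMGF, ratioMGF, logRatio, mul_comm]

variable {p q : Dist d} (hp : ∀ i, 0 < p.1 i) (hq : ∀ i, 0 < q.1 i)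

include hp in
lemma ratioMGF_pos (q : Dist d) (t : ℝ) : 0 < ratioMGF p q t := by
  have hne : (Finset.univ : Finset (Fin d)).Nonempty := by
    by_contra h
    have := p.2.2
    rw [Finset.not_nonempty_iff_eq_empty.1 h] at this
    simp at this
  exact Finset.sum_pos (fun i _ => mul_pos (hp i) (Real.exp_pos _)) hne

lemma ratioMGF_zero (p q : Dist d) : ratioMGF p q 0 = 1 := by
  simpa [ratioMGF] using p.2.2

include hp hq in
lemma mul_exp_logRatio (i : Fin d) : p.1 i * Real.exp (logRatio p q i) = q.1 i := by
  rw [logRatio, Real.exp_log (div_pos (hq i) (hp i)), mul_div_cancel₀ _ (hp i).ne']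

include hp hq in
lemma ratioMGF_one : ratioMGF p q 1 = 1 := by
  simp only [ratioMGF, one_mul, mul_exp_logRatio hp hq]
  exact q.2.2

include hp hq in
lemma sum_rpow_eq_ratioMGF (t : ℝ) :
    ∑ i, p.1 i ^ (1 - t) * q.1 i ^ t = ratioMGF p q t := by
  refine Finset.sum_congr rfl fun i _ => ?_
  rw [Real.rpow_sub (hp i), Real.rpow_one, logRatio, mul_comm t,
    ← Real.rpow_def_of_pos (div_pos (hq i) (hp i)), Real.div_rpow (hq i).le (hp i).le]
  ring

lemma hasDerivAt_ratioMGF (p q : Dist d) (t : ℝ) :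
    HasDerivAt (ratioMGF p q)
      (∑ i, p.1 i * (Real.exp (t * logRatio p q i) * logRatio p q i)) t := by
  unfold ratioMGF
  refine HasDerivAt.fun_sum fun i _ => ?_
  exact (((hasDerivAt_mul_const (logRatio p q i)).exp).const_mul (p.1 i))

lemma convexOn_ratioMGF (p q : Dist d) : ConvexOn ℝ Set.univ (ratioMGF p q) := by
  refine ⟨convex_univ, fun x _ y _ a b ha hb hab => ?_⟩
  simp only [ratioMGF, smul_eq_mul, Finset.mul_sum]
  rw [← Finset.sum_add_distrib]
  refine Finset.sum_le_sum fun i _ => ?_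
  have := convexOn_exp.2 (Set.mem_univ (x * logRatio p q i)) (Set.mem_univ (y * logRatio p q i))
    ha hb hab
  simp only [smul_eq_mul] at this
  calc _ = p.1 i * Real.exp (a * (x * logRatio p q i) + b * (y * logRatio p q i)) := by ring_nf
    _ ≤ _ := mul_le_mul_of_nonneg_left this (p.2.1 i)
    _ = _ := by ring

include hp hq in
-- A convex function equal to 1 at 0 and at 1 cannot drop below 1 outside the interval: 0 or 1 would
-- then be a convex combination forcing a value below 1.
lemma one_le_ratioMGF {t : ℝ} (ht : t ∉ Set.Icc (0 : ℝ) 1) : 1 ≤ ratioMGF p q t := by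
  have h0 := ratioMGF_zero p q
  have h1 := ratioMGF_one hp hq
  by_contra! hlt
  rw [Set.mem_Icc, not_and_or, not_le, not_le] at ht
  rcases ht with ht | ht
  · have hden : 0 < 1 - t := by linarith
    have := (convexOn_ratioMGF p q).2 (Set.mem_univ t) (Set.mem_univ 1)
      (by positivity : 0 ≤ 1 / (1 - t))
      (div_nonneg (by linarith) hden.le : 0 ≤ -t / (1 - t)) (by field_simp; ring)
    simp only [smul_eq_mul] at this
    rw [show 1 / (1 - t) * t + -t / (1 - t) * 1 = 0 by field_simp; ring, h0, h1] at this
    have h2 : 1 / (1 - t) * ratioMGF p q t < 1 / (1 - t) * 1 :=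
      mul_lt_mul_of_pos_left hlt (by positivity)
    have h3 : 1 / (1 - t) * 1 + -t / (1 - t) * 1 = 1 := by field_simp; ring
    linarith
  · have hden : 0 < t := by linarith
    have := (convexOn_ratioMGF p q).2 (Set.mem_univ t) (Set.mem_univ 0)
      (by positivity : 0 ≤ 1 / t)
      (div_nonneg (by linarith) hden.le : 0 ≤ (t - 1) / t) (by field_simp; ring)
    simp only [smul_eq_mul] at this
    rw [show 1 / t * t + (t - 1) / t * 0 = 1 by field_simp; ring, h0, h1] at this
    have h2 : 1 / t * ratioMGF p q t < 1 / t * 1 :=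
      mul_lt_mul_of_pos_left hlt (by positivity)
    have h3 : 1 / t * 1 + (t - 1) / t * 1 = 1 := by field_simp; ring
    linarith

include hp hq in
/-- The moment generating function attains its minimum over `ℝ` in `[0, 1]`. -/
lemma exists_isMin_ratioMGF :
    ∃ t ∈ Set.Icc (0 : ℝ) 1, ∀ u, ratioMGF p q t ≤ ratioMGF p q u := by
  have hcont : Continuous (ratioMGF p q) :=
    continuous_iff_continuousAt.2 fun t => (hasDerivAt_ratioMGF p q t).continuousAt
  obtain ⟨t, ht, hmin⟩ := isCompact_Icc.exists_isMinOn (Set.nonempty_Icc.2 zero_le_one)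
    hcont.continuousOn
  refine ⟨t, ht, fun u => ?_⟩
  by_cases hu : u ∈ Set.Icc (0 : ℝ) 1
  · exact hmin hu
  · have h0 : ratioMGF p q t ≤ ratioMGF p q 0 := hmin (by simp)
    rw [ratioMGF_zero] at h0
    exact h0.trans (one_le_ratioMGF hp hq hu)

include hp in
lemma fenchelLegendre_logMGF_zero {t : ℝ} (hmin : ∀ u, ratioMGF p q t ≤ ratioMGF p q u) :
    fenchelLegendre (logMGF p q) 0 = ((-Real.log (ratioMGF p q t) : ℝ) : EReal) := by
  refine le_antisymm (iSup_le fun u => ?_) (le_iSup_of_le t ?_)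
  · rw [EReal.coe_le_coe_iff, logMGF_eq, mul_zero, zero_sub, neg_le_neg_iff]
    exact Real.log_le_log (ratioMGF_pos hp q t) (hmin u)
  · rw [EReal.coe_le_coe_iff, logMGF_eq, mul_zero, zero_sub]

include hp hq in
lemma chernoffInformation_eq {t : ℝ} (ht : t ∈ Set.Icc (0 : ℝ) 1)
    (hmin : ∀ u, ratioMGF p q t ≤ ratioMGF p q u) :
    chernoffInformation p q = -Real.log (ratioMGF p q t) := by
  simp only [chernoffInformation, sum_rpow_eq_ratioMGF hp hq]
  have hle : ∀ u : unitInterval, -Real.log (ratioMGF p q u) ≤ -Real.log (ratioMGF p q t) :=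
    fun u => neg_le_neg (Real.log_le_log (ratioMGF_pos hp q t) (hmin u))
  refine le_antisymm (ciSup_le hle) ?_
  exact le_ciSup (f := fun u : unitInterval => -Real.log (ratioMGF p q u))
    ⟨_, Set.forall_mem_range.2 hle⟩ ⟨t, ht⟩

include hp hq in
/-- Chernoff's lower bound on the Bayesian error of testing `p` against `q`. -/
lemma eventually_le_sum_min_wordProb {γ : ℝ} (hγ : 0 < γ) {t : ℝ}
    (ht : t ∈ Set.Icc (0 : ℝ) 1) (hmin : ∀ u, ratioMGF p q t ≤ ratioMGF p q u)
    {ε : ℝ} (hε : 0 < ε) :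
    ∀ᶠ n : ℕ in atTop, min 1 γ / 2 * Real.exp (n * (Real.log (ratioMGF p q t) - ε)) ≤
      ∑ x : Fin n → Fin d, min (wordProb q x) (γ * wordProb p x) := by
  set L := logRatio p q with hL
  set f := ratioMGF p q t with hf
  have hfpos : 0 < f := ratioMGF_pos hp q t
  -- The tilted law: stationarity of the MGF at its minimizer `t` says that `L` has mean zero under
  -- `r`, so `r`-typical words have `|∑ L| ≤ n ε`.
  set r : Fin d → ℝ := fun i => p.1 i * Real.exp (t * L i) / f with hrdef
  have hr : r ∈ stdSimplex ℝ (Fin d) := by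
    refine ⟨fun i => div_nonneg (mul_nonneg (hp i).le (Real.exp_pos _).le) hfpos.le, ?_⟩
    simp only [hrdef]
    rw [← Finset.sum_div]
    exact div_self hfpos.ne'
  have hmean : ∑ i, r i * L i = 0 := by
    have hloc : IsLocalMin (ratioMGF p q) t := Filter.Eventually.of_forall hmin
    have h0 := hloc.hasDerivAt_eq_zero (hasDerivAt_ratioMGF p q t)
    have : ∑ i, r i * L i = (∑ i, p.1 i * (Real.exp (t * L i) * L i)) / f := by
      rw [Finset.sum_div]
      exact Finset.sum_congr rfl fun i _ => by simp only [hrdef]; ring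
    rw [this, h0, zero_div]
  filter_upwards [eventually_half_le_sum_words hr hmean hε] with n hn
  have hγ1 : 0 < min 1 γ := lt_min one_pos hγ
  have hword : ∀ x : Fin n → Fin d, ∏ k, r (x k) =
      wordProb p x * Real.exp (t * ∑ k, L (x k)) / f ^ n := fun x => by
    simp only [hrdef, Finset.prod_div_distrib, Finset.prod_mul_distrib, wordProb,
      ← Real.exp_sum, Finset.mul_sum, Finset.prod_const, Finset.card_univ, Fintype.card_fin]
  have hwq : ∀ x : Fin n → Fin d,
      wordProb q x = wordProb p x * Real.exp (∑ k, L (x k)) := fun x => by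
    simp only [wordProb, Real.exp_sum, ← Finset.prod_mul_distrib]
    exact Finset.prod_congr rfl fun k _ => (mul_exp_logRatio hp hq _).symm
  have hpw : ∀ x : Fin n → Fin d, 0 < wordProb p x := fun x =>
    Finset.prod_pos fun k _ => hp _
  have hexp : Real.exp (n * (Real.log f - ε)) = f ^ n * Real.exp (-(n * ε)) := by
    rw [mul_sub, sub_eq_add_neg, Real.exp_add, Real.exp_nat_mul, Real.exp_log hfpos]
  have hfn : 0 < f ^ n := pow_pos hfpos n
  calc min 1 γ / 2 * Real.exp (n * (Real.log f - ε))
      = min 1 γ * Real.exp (n * (Real.log f - ε)) * (1 / 2) := by ring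
    _ ≤ min 1 γ * Real.exp (n * (Real.log f - ε)) *
          ∑ x : Fin n → Fin d with |∑ k, L (x k)| ≤ n * ε, ∏ k, r (x k) :=
        mul_le_mul_of_nonneg_left hn (mul_pos hγ1 (Real.exp_pos _)).le
    _ = ∑ x : Fin n → Fin d with |∑ k, L (x k)| ≤ n * ε,
          min 1 γ * (wordProb p x * Real.exp (t * ∑ k, L (x k) - n * ε)) := by
        rw [Finset.mul_sum]
        refine Finset.sum_congr rfl fun x _ => ?_
        rw [hword, hexp, sub_eq_add_neg, Real.exp_add]
        field_simp
    _ ≤ ∑ x : Fin n → Fin d with |∑ k, L (x k)| ≤ n * ε,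
          min (wordProb q x) (γ * wordProb p x) := by
        refine Finset.sum_le_sum fun x hx => ?_
        rw [Finset.mem_filter] at hx
        obtain ⟨hlo, hhi⟩ := abs_le.1 hx.2
        have hA : 0 ≤ wordProb p x * Real.exp (t * ∑ k, L (x k) - n * ε) :=
          (mul_pos (hpw x) (Real.exp_pos _)).le
        -- With `S = ∑ L`, compare `exp (t S - n ε)` with `exp S` and with 1: this needs `(1 - t) S
        -- ≥ -n ε` and `t S ≤ n ε`, both consequences of `|S| ≤ n ε` and `t ∈ [0, 1]`.
        refine le_min ?_ ?_
        · refine (mul_le_of_le_one_left hA (min_le_left _ _)).trans ?_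
          rw [hwq]
          refine mul_le_mul_of_nonneg_left (Real.exp_le_exp.2 ?_) (hpw x).le
          have h0 := ht.1
          have h1 := ht.2
          nlinarith
        · refine mul_le_mul (min_le_right _ _) ?_ hA hγ.le
          refine mul_le_of_le_one_right (hpw x).le (Real.exp_le_one_iff.2 ?_)
          have h0 := ht.1
          have h1 := ht.2
          nlinarith
    _ ≤ _ := by
        refine Finset.sum_le_univ_sum_of_nonneg fun x => le_min ?_ ?_
        · rw [hwq]; exact (mul_pos (hpw x) (Real.exp_pos _)).le
        · exact (mul_pos hγ (hpw x)).le

end Chernoff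

/-! ### Error bounds for the likelihood ratio test -/

section LikelihoodRatioTest

variable {d n : ℕ}

open Classical in
/-- The test that declares an attack when the log-likelihood ratio of the word is nonnegative. -/
noncomputable def ratioTest (p q : Dist d) (n : ℕ) : DecisionRule d n :=
  fun x => if 0 ≤ ∑ k, logRatio p q (x k) then 1 else 0

lemma falseAlarmProb_ratioTest_le (p q : Dist d) (n : ℕ) {t : ℝ} (ht : 0 ≤ t) :
    falseAlarmProb p (ratioTest p q n) ≤ ratioMGF p q t ^ n := by
  refine sum_words_le_pow n p.2.1 (logRatio p q) fun x => ?_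
  unfold ratioTest
  split_ifs with hx
  · simpa using mul_nonneg ht hx
  · simpa using (Real.exp_pos _).le

/-- The letters follow an arbitrary `r`, not the `q` of the test, since the attacker need not play
`q*`. -/
lemma missProb_ratioTest_le (p q r : Dist d) (n : ℕ) {s : ℝ} (hs : 0 ≤ s) :
    missProb r (ratioTest p q n) ≤ (∑ i, r.1 i * Real.exp (-s * logRatio p q i)) ^ n := by
  refine sum_words_le_pow n r.2.1 (logRatio p q) fun x => ?_
  unfold ratioTest
  split_ifs with hx
  · simpa using (Real.exp_pos _).le
  · simpa using mul_nonpos_of_nonneg_of_nonpos hs (not_le.1 hx).le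

/-- Changing measure from `q` to `p` adds 1 to the tilt, so both error types of the test get the
same Chernoff bound. -/
lemma sum_mul_exp_logRatio {p q : Dist d} (hp : ∀ i, 0 < p.1 i) (hq : ∀ i, 0 < q.1 i) (t : ℝ) :
    ∑ i, q.1 i * Real.exp (-(1 - t) * logRatio p q i) = ratioMGF p q t := by
  refine Finset.sum_congr rfl fun i _ => ?_
  nth_rewrite 1 [← mul_exp_logRatio hp hq i]
  rw [mul_assoc, ← Real.exp_add]
  ring_nf

/-- Each word contributes a convex combination, with weight `φ x`, of the two quantities in the
minimum. -/
lemma sum_min_wordProb_le (p q : Dist d) {γ : ℝ} (φ : DecisionRule d n) :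
    ∑ x : Fin n → Fin d, min (wordProb q x) (γ * wordProb p x) ≤
      missProb q φ + γ * falseAlarmProb p φ := by
  rw [missProb, falseAlarmProb, Finset.mul_sum, ← Finset.sum_add_distrib]
  refine Finset.sum_le_sum fun x _ => ?_
  have h0 := (φ x).2.1
  have h1 := (φ x).2.2
  have h2 := min_le_left (wordProb q x) (γ * wordProb p x)
  have h3 := min_le_right (wordProb q x) (γ * wordProb p x)
  nlinarith

/-- Turns (A4) into positivity of the mean log-likelihood ratio under every `r ∈ Q`. -/
lemma relEntropy_sub {p q r : Dist d} (hp : ∀ i, 0 < p.1 i) (hq : ∀ i, 0 < q.1 i)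
    (hr : ∀ i, 0 < r.1 i) :
    relEntropy r p - relEntropy r q = ∑ i, r.1 i * logRatio p q i := by
  rw [relEntropy, relEntropy, ← Finset.sum_sub_distrib]
  refine Finset.sum_congr rfl fun i _ => ?_
  rw [logRatio, Real.log_div (hr i).ne' (hp i).ne', Real.log_div (hr i).ne' (hq i).ne',
    Real.log_div (hq i).ne' (hp i).ne']
  ring

end LikelihoodRatioTest

/-! ### Consequences of pure deviations from an equilibrium -/

section Equilibrium

variable {d n : ℕ}

lemma continuous_prob (i : Fin d) : Continuous fun q : Dist d => q.1 i :=
  (continuous_apply i).comp continuous_subtype_val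

lemma continuous_expectation (g : Fin d → ℝ) : Continuous fun q : Dist d => ∑ i, q.1 i * g i :=
  continuous_finsetSum _ fun i _ => (continuous_prob i).mul continuous_const

lemma continuous_decision (x : Fin n → Fin d) :
    Continuous fun φ : DecisionRule d n => (φ x : ℝ) :=
  continuous_subtype_val.comp (continuous_apply x)

lemma continuous_missProb :
    Continuous fun z : Dist d × DecisionRule d n => missProb z.1 z.2 :=
  continuous_finsetSum _ fun x _ =>
    (continuous_const.sub ((continuous_decision x).comp continuous_snd)).mul
      (continuous_finsetProd _ fun k _ => (continuous_prob (x k)).comp continuous_fst)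

lemma continuous_falseAlarmProb (p : Dist d) :
    Continuous fun φ : DecisionRule d n => falseAlarmProb p φ :=
  continuous_finsetSum _ fun x _ => (continuous_decision x).mul continuous_const

lemma integrable_of_continuous {X : Type*} [TopologicalSpace X] [CompactSpace X]
    [MeasurableSpace X] [OpensMeasurableSpace X] {f : X → ℝ} (hf : Continuous f)
    (μ : Measure X) [IsFiniteMeasure μ] : Integrable f μ :=
  hf.integrable_of_hasCompactSupport (HasCompactSupport.of_compactSpace f)

lemma mixedExt_dirac_right {S T : Type} [MeasurableSpace S] [MeasurableSpace T]
    {u : S → T → ℝ} (hu : Measurable fun z : S × T => u z.1 z.2)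
    (σ : ProbabilityMeasure S) (b : T) :
    mixedExt u σ ⟨Measure.dirac b, inferInstance⟩ = ∫ a, u a b ∂(σ : Measure S) := by
  unfold mixedExt
  rw [ProbabilityMeasure.coe_mk, Measure.prod_dirac,
    integral_map (by fun_prop) hu.aestronglyMeasurable]

lemma mixedExt_dirac_left {S T : Type} [MeasurableSpace S] [MeasurableSpace T]
    {u : S → T → ℝ} (hu : Measurable fun z : S × T => u z.1 z.2)
    (a : S) (τ : ProbabilityMeasure T) :
    mixedExt u ⟨Measure.dirac a, inferInstance⟩ τ = ∫ b, u a b ∂(τ : Measure T) := by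
  unfold mixedExt
  rw [ProbabilityMeasure.coe_mk, Measure.dirac_prod,
    integral_map (by fun_prop) hu.aestronglyMeasurable]

variable {p : Dist d} {Q : Set (Dist d)} {c : Q → ℝ≥0} {γ : ℝ}
  {σ : ProbabilityMeasure Q} {τ : ProbabilityMeasure (DecisionRule d n)}

lemma continuous_defenderUtility :
    Continuous fun z : Q × DecisionRule d n => defenderUtility p Q γ n z.1 z.2 := by
  have h1 : Continuous fun z : Q × DecisionRule d n => missProb z.1.1 z.2 :=
    continuous_missProb.comp (by fun_prop : Continuous fun z : Q × DecisionRule d n => (z.1.1, z.2))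
  have h2 : Continuous fun z : Q × DecisionRule d n => falseAlarmProb p z.2 :=
    (continuous_falseAlarmProb p).comp continuous_snd
  exact (h1.add (continuous_const.mul h2)).neg

lemma continuous_attackerUtility (hc : Continuous c) :
    Continuous fun z : Q × DecisionRule d n => attackerUtility Q c n z.1 z.2 := by
  have h1 : Continuous fun z : Q × DecisionRule d n => missProb z.1.1 z.2 :=
    continuous_missProb.comp (by fun_prop : Continuous fun z : Q × DecisionRule d n => (z.1.1, z.2))
  exact h1.sub (NNReal.continuous_coe.comp (hc.comp continuous_fst))

/-- The equilibrium error is at most the error of any test against the attacker's strategy. -/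
lemma classError_le_of_isMixedNash
    (h : IsMixedNash (attackerUtility Q c n) (defenderUtility p Q γ n) σ τ)
    (φ : DecisionRule d n) :
    mixedExt (classError p Q γ n) σ τ ≤ ∫ q : Q, classError p Q γ n q φ ∂(σ : Measure Q) := by
  have h1 := h.2 ⟨Measure.dirac φ, inferInstance⟩
  rw [mixedExt_dirac_right continuous_defenderUtility.measurable] at h1
  have h2 : mixedExt (classError p Q γ n) σ τ = -mixedExt (defenderUtility p Q γ n) σ τ :=
    integral_neg _
  have h3 : ∫ q : Q, classError p Q γ n q φ ∂(σ : Measure Q) =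
      -∫ q : Q, defenderUtility p Q γ n q φ ∂(σ : Measure Q) := integral_neg _
  rw [h2, h3]
  exact neg_le_neg h1

/-- The equilibrium error is at least the attacker's excess cost plus the Bayesian error of the
test of `p` against `q₀`. -/
lemma le_classError_of_isMixedNash [CompactSpace Q] (hc : Continuous c)
    (h : IsMixedNash (attackerUtility Q c n) (defenderUtility p Q γ n) σ τ) (q₀ : Q) :
    ∫ q : Q, ((c q : ℝ) - c q₀) ∂(σ : Measure Q) +
      ∑ x : Fin n → Fin d, min (wordProb q₀.1 x) (γ * wordProb p x) ≤
    mixedExt (classError p Q γ n) σ τ := by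
  have h1 := h.1 ⟨Measure.dirac q₀, inferInstance⟩
  rw [mixedExt_dirac_left (continuous_attackerUtility hc).measurable] at h1
  have hcR : Continuous fun q : Q => (c q : ℝ) := NNReal.continuous_coe.comp hc
  have hI : Integrable (fun z : Q × DecisionRule d n => attackerUtility Q c n z.1 z.2)
      ((σ : Measure Q).prod (τ : Measure (DecisionRule d n))) :=
    integrable_of_continuous (continuous_attackerUtility hc) _
  have hIF : Integrable (fun φ : DecisionRule d n => γ * falseAlarmProb p φ)
      (τ : Measure (DecisionRule d n)) :=
    integrable_of_continuous (continuous_const.mul (continuous_falseAlarmProb p)) _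
  have hIc : Integrable (fun q : Q => (c q : ℝ)) (σ : Measure Q) := integrable_of_continuous hcR _
  have hIm : Integrable (fun φ : DecisionRule d n => missProb q₀.1 φ)
      (τ : Measure (DecisionRule d n)) :=
    integrable_of_continuous (continuous_missProb.comp (Continuous.prodMk_right q₀.1)) _
  -- The error is the attacker's utility plus terms each depending on one player only, so the
  -- attacker's optimality bounds the error from below.
  have hE : mixedExt (classError p Q γ n) σ τ = mixedExt (attackerUtility Q c n) σ τ +
      ∫ q : Q, (c q : ℝ) ∂(σ : Measure Q) +
      ∫ φ, γ * falseAlarmProb p φ ∂(τ : Measure (DecisionRule d n)) := by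
    have e1 : ∫ z : Q × DecisionRule d n, (c z.1 : ℝ)
        ∂((σ : Measure Q).prod (τ : Measure (DecisionRule d n))) =
        ∫ q : Q, (c q : ℝ) ∂(σ : Measure Q) := by
      rw [integral_fun_fst (f := fun q : Q => (c q : ℝ))]; simp
    have e2 : ∫ z : Q × DecisionRule d n, γ * falseAlarmProb p z.2
        ∂((σ : Measure Q).prod (τ : Measure (DecisionRule d n))) =
        ∫ φ, γ * falseAlarmProb p φ ∂(τ : Measure (DecisionRule d n)) := by
      rw [integral_fun_snd (f := fun φ : DecisionRule d n => γ * falseAlarmProb p φ)]; simp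
    rw [← e1, ← e2, mixedExt, mixedExt, ← integral_add hI (hIc.comp_fst _),
      ← integral_add (f := fun z : Q × DecisionRule d n => attackerUtility Q c n z.1 z.2 + c z.1)
        (hI.add (hIc.comp_fst _)) (hIF.comp_snd _)]
    refine integral_congr_ae (Eventually.of_forall fun z => ?_)
    simp only [classError, defenderUtility, attackerUtility]
    ring
  have h2 : ∫ φ, attackerUtility Q c n q₀ φ ∂(τ : Measure (DecisionRule d n)) =
      ∫ φ, missProb q₀.1 φ ∂(τ : Measure (DecisionRule d n)) - c q₀ := by
    simp only [attackerUtility]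
    rw [integral_sub hIm (integrable_const _)]
    simp
  have h3 : ∑ x : Fin n → Fin d, min (wordProb q₀.1 x) (γ * wordProb p x) ≤
      ∫ φ, missProb q₀.1 φ ∂(τ : Measure (DecisionRule d n)) +
      ∫ φ, γ * falseAlarmProb p φ ∂(τ : Measure (DecisionRule d n)) := by
    rw [← integral_add hIm hIF]
    have := integral_mono (μ := (τ : Measure (DecisionRule d n))) (integrable_const _)
      (hIm.add hIF) fun φ => sum_min_wordProb_le (γ := γ) p q₀.1 φ
    simpa using this
  have h4 : ∫ q : Q, ((c q : ℝ) - c q₀) ∂(σ : Measure Q) =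
      ∫ q : Q, (c q : ℝ) ∂(σ : Measure Q) - c q₀ := by
    rw [integral_sub hIc (integrable_const _)]
    simp
  linarith

end Equilibrium

/-- A continuous function with a unique minimizer is bounded away from its minimum outside any
neighbourhood of the minimizer. -/
lemma exists_gap_of_unique_min {X : Type*} [TopologicalSpace X] [CompactSpace X] {f : X → ℝ}
    (hf : Continuous f) {a : X} (ha : ∀ x, x ≠ a → f a < f x) {U : Set X} (hU : IsOpen U)
    (haU : a ∈ U) : ∃ η > 0, ∀ x ∉ U, η ≤ f x - f a := by
  rcases Uᶜ.eq_empty_or_nonempty with hE | hne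
  · exact ⟨1, one_pos, fun x hx => absurd (show x ∈ Uᶜ from hx) (by simp [hE])⟩
  · obtain ⟨y, hy, hmin⟩ := hU.isClosed_compl.isCompact.exists_isMinOn hne hf.continuousOn
    refine ⟨f y - f a, sub_pos.2 (ha y fun h => hy (h ▸ haU)), fun x hx => ?_⟩
    exact sub_le_sub_right (hmin hx) _

/-- The constants `K` do not depend on `n`, so they contribute `log K / n → 0`. -/
lemma tendsto_log_div_of_exp_bounds {E : ℕ → ℝ} {l : ℝ}
    (hlo : ∃ K > 0, ∀ ε > 0, ∀ᶠ n : ℕ in atTop, K * Real.exp (n * (l - ε)) ≤ E n)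
    (hhi : ∃ K > 0, ∀ ε > 0, ∀ᶠ n : ℕ in atTop, E n ≤ K * Real.exp (n * (l + ε))) :
    Tendsto (fun n : ℕ => 1 / (n : ℝ) * Real.log (E n)) atTop (𝓝 l) := by
  obtain ⟨K, hK, hlo⟩ := hlo
  obtain ⟨K', hK', hhi⟩ := hhi
  have hlim : ∀ K : ℝ, Tendsto (fun n : ℕ => Real.log K / (n : ℝ)) atTop (𝓝 0) := fun K =>
    tendsto_const_div_atTop_nhds_zero_nat _
  rw [Metric.tendsto_nhds]
  intro ε hε
  filter_upwards [hlo (ε / 2) (half_pos hε), hhi (ε / 2) (half_pos hε), eventually_gt_atTop 0,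
    (hlim K).eventually (lt_mem_nhds (neg_lt_zero.2 (half_pos hε))),
    (hlim K').eventually (gt_mem_nhds (half_pos hε))] with n h1 h2 hn h3 h4
  have hn' : (0 : ℝ) < n := Nat.cast_pos.2 hn
  have hEpos : 0 < E n := (mul_pos hK (Real.exp_pos _)).trans_le h1
  have h5 := Real.log_le_log (mul_pos hK (Real.exp_pos _)) h1
  have h6 := Real.log_le_log hEpos h2
  rw [Real.log_mul hK.ne' (Real.exp_pos _).ne', Real.log_exp] at h5
  rw [Real.log_mul hK'.ne' (Real.exp_pos _).ne', Real.log_exp] at h6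
  rw [lt_div_iff₀ hn'] at h3
  rw [div_lt_iff₀ hn'] at h4
  rw [Real.dist_eq, one_div_mul_eq_div, abs_lt, lt_sub_iff_add_lt, sub_lt_iff_lt_add,
    lt_div_iff₀ hn', div_lt_iff₀ hn']
  constructor <;> nlinarith

end AdvTest

/-! ### The error exponent at equilibrium -/

theorem mainTheorem1 (d : ℕ)
    (p : AdvTest.Dist d) (Q : Set (AdvTest.Dist d)) (c : Q → ℝ≥0) (γ : ℝ) (hγ : 0 < γ)
    -- (A1)
    (hQ_closed : IsClosed Q) (hpQ : p ∉ Q)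
    -- (A2)
    (hp_pos : ∀ i, 0 < p.1 i) (hQ_pos : ∀ q ∈ Q, ∀ i, 0 < q.1 i)
    -- (A3): `qs` is the unique minimizer of `c` on `Q`
    (hc : Continuous c) (qs : Q) (hqs_min : ∀ q : Q, c qs ≤ c q)
    (hqs_unique : ∀ q' : Q, (∀ q : Q, c q' ≤ c q) → q' = qs)
    -- (A4)
    (hfar : {μ : AdvTest.Dist d |
      AdvTest.relEntropy μ p ≤ AdvTest.relEntropy μ qs.1} ∩ Q = ∅)
    -- a mixed Nash equilibrium for every sample size `n ≥ 1`
    (σA : ∀ _ : ℕ, ProbabilityMeasure Q)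
    (σD : ∀ n : ℕ, ProbabilityMeasure (AdvTest.DecisionRule d n))
    (hNash : ∀ n : ℕ, 1 ≤ n → AdvTest.IsMixedNash
      (AdvTest.attackerUtility Q c n) (AdvTest.defenderUtility p Q γ n) (σA n) (σD n)) :
    Tendsto
      (fun n : ℕ => (((1 / (n : ℝ)) *
        Real.log (AdvTest.mixedExt (AdvTest.classError p Q γ n) (σA n) (σD n)) : ℝ) : EReal))
      atTop (𝓝 (-AdvTest.fenchelLegendre (AdvTest.logMGF p qs.1) 0)) ∧
    AdvTest.fenchelLegendre (AdvTest.logMGF p qs.1) 0 =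
      ((AdvTest.chernoffInformation p qs.1 : ℝ) : EReal) := by
  open AdvTest in
  have hqs_pos := hQ_pos qs.1 qs.2
  obtain ⟨t, ht, hmin⟩ := exists_isMin_ratioMGF hp_pos hqs_pos
  rw [chernoffInformation_eq hp_pos hqs_pos ht hmin, fenchelLegendre_logMGF_zero hp_pos hmin]
  refine ⟨?_, rfl⟩
  rw [← EReal.coe_neg, neg_neg]
  refine (continuous_coe_real_ereal.tendsto _).comp ?_
  have : CompactSpace Q := isCompact_iff_compactSpace.1 hQ_closed.isCompact
  have hcR : Continuous fun q : Q => (c q : ℝ) := NNReal.continuous_coe.comp hc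
  have hcost : ∀ q : Q, 0 ≤ (c q : ℝ) - c qs := fun q => sub_nonneg.2 (hqs_min q)
  have hbayes : ∀ n : ℕ, 0 ≤ ∑ x : Fin n → Fin d, min (wordProb qs.1 x) (γ * wordProb p x) :=
    fun n => Finset.sum_nonneg fun x _ => le_min (Finset.prod_nonneg fun k _ => qs.1.2.1 _)
      (mul_nonneg hγ.le (Finset.prod_nonneg fun k _ => p.2.1 _))
  have hfpos : 0 < ratioMGF p qs.1 t := ratioMGF_pos hp_pos qs.1 t
  refine tendsto_log_div_of_exp_bounds
    ⟨min 1 γ / 2, half_pos (lt_min one_pos hγ), fun ε hε => ?_⟩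
    ⟨2 * (1 + γ), by positivity, fun ε hε => ?_⟩
  · filter_upwards [eventually_le_sum_min_wordProb hp_pos hqs_pos hγ ht hmin hε,
      eventually_ge_atTop 1] with n hn hn1
    have h1 := le_classError_of_isMixedNash hc (hNash n hn1) qs
    have h2 := integral_nonneg (μ := (σA n : Measure Q)) (f := fun q : Q => (c q : ℝ) - c qs) hcost
    linarith
  · -- the log-likelihood ratio has mean bounded below on `Q`
    obtain ⟨m, hm, hmQ⟩ : ∃ m > 0, ∀ q : Q, m ≤ ∑ i, q.1.1 i * logRatio p qs.1 i := by
      have hcont : Continuous fun q : Q => ∑ i, q.1.1 i * logRatio p qs.1 i :=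
        (continuous_expectation (logRatio p qs.1)).comp continuous_subtype_val
      obtain ⟨q₀, -, h₀⟩ := isCompact_univ.exists_isMinOn ⟨qs, Set.mem_univ _⟩ hcont.continuousOn
      refine ⟨_, ?_, fun q => h₀ (Set.mem_univ q)⟩
      simp only
      rw [← relEntropy_sub hp_pos hqs_pos (hQ_pos q₀.1 q₀.2), gt_iff_lt, sub_pos]
      by_contra! hle
      exact (hfar ▸ (⟨hle, q₀.2⟩ : q₀.1 ∈ {μ : Dist d | relEntropy μ p ≤ relEntropy μ qs.1} ∩ Q) :
        q₀.1 ∈ (∅ : Set (Dist d)))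
    obtain ⟨s, hs, ρ, hρ0, hρ1, hρ⟩ := exists_sum_mul_exp_le (logRatio p qs.1) hm
    set a : ℝ := Real.exp (Real.log (ratioMGF p qs.1 t) + ε) with ha
    have hfa : ratioMGF p qs.1 t < a := by
      rw [ha, Real.exp_add, Real.exp_log hfpos]
      exact lt_mul_of_one_lt_right hfpos (Real.one_lt_exp_iff.2 hε)
    have hcont : Continuous fun q : Q =>
        ∑ i, q.1.1 i * Real.exp (-(1 - t) * logRatio p qs.1 i) :=
      (continuous_expectation _).comp continuous_subtype_val
    -- At `q*` this sum equals the minimal MGF value, which is below `a`, so `U` is a neighbourhood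
    -- of `q*` on which misses are at most `a ^ n`.
    set U : Set Q := {q | ∑ i, q.1.1 i * Real.exp (-(1 - t) * logRatio p qs.1 i) < a} with hU
    have hUo : IsOpen U := isOpen_lt hcont continuous_const
    have hqsU : qs ∈ U := by
      rw [hU, Set.mem_ofPred_eq, sum_mul_exp_logRatio hp_pos hqs_pos]
      exact hfa
    have hstrict : ∀ q : Q, q ≠ qs → (c qs : ℝ) < c q := fun q hq => by
      refine lt_of_le_of_ne (hqs_min q) fun heq => hq (hqs_unique q fun q' => ?_)
      rw [← NNReal.coe_injective heq]
      exact hqs_min q'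
    obtain ⟨η, hη, hgap⟩ := exists_gap_of_unique_min hcR hstrict hUo hqsU
    -- Outside `U` the excess cost is at least `η`, so `ρ ^ n` is paid for by the cost term.
    have hmiss : ∀ (n : ℕ) (q : Q), missProb q.1 (ratioTest p qs.1 n) ≤
        a ^ n + ρ ^ n / η * ((c q : ℝ) - c qs) := by
      intro n q
      have hρn : 0 ≤ ρ ^ n / η := by positivity
      by_cases hq : q ∈ U
      · have h1 := missProb_ratioTest_le p qs.1 q.1 n (sub_nonneg.2 ht.2)
        have h2 := pow_le_pow_left₀ (Finset.sum_nonneg fun i _ =>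
          mul_nonneg (q.1.2.1 i) (Real.exp_pos _).le) (le_of_lt hq) n
        have h3 := mul_nonneg hρn (hcost q)
        linarith
      · have h1 := missProb_ratioTest_le p qs.1 q.1 n hs.le
        have h2 := pow_le_pow_left₀ (Finset.sum_nonneg fun i _ =>
          mul_nonneg (q.1.2.1 i) (Real.exp_pos _).le) (hρ q.1.1 q.1.2 (hmQ q)) n
        have h3 := mul_le_mul_of_nonneg_left (hgap q hq) hρn
        rw [div_mul_cancel₀ _ hη.ne'] at h3
        have h4 : 0 ≤ a ^ n := by positivity
        linarith
    filter_upwards [eventually_ge_atTop 1, (tendsto_pow_atTop_nhds_zero_of_lt_one hρ0.le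
      hρ1).eventually (gt_mem_nhds (half_pos hη))] with n hn1 hρn
    have hlo := le_classError_of_isMixedNash hc (hNash n hn1) qs
    have hup := classError_le_of_isMixedNash (hNash n hn1) (ratioTest p qs.1 n)
    set E := mixedExt (classError p Q γ n) (σA n) (σD n)
    have hIc : Integrable (fun q : Q => (c q : ℝ) - c qs) (σA n : Measure Q) :=
      integrable_of_continuous (hcR.sub continuous_const) _
    have hE0 : ∫ q : Q, ((c q : ℝ) - c qs) ∂(σA n : Measure Q) ≤ E := by linarith [hbayes n]
    have hC0 := integral_nonneg (μ := (σA n : Measure Q)) (f := fun q : Q => (c q : ℝ) - c qs) hcost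
    have hIe : Integrable (fun q : Q => classError p Q γ n q (ratioTest p qs.1 n))
        (σA n : Measure Q) :=
      integrable_of_continuous
        ((continuous_defenderUtility (p := p) (γ := γ)).comp (Continuous.prodMk_left _)).neg _
    have hbound : ∫ q : Q, classError p Q γ n q (ratioTest p qs.1 n) ∂(σA n : Measure Q) ≤
        (1 + γ) * a ^ n + ρ ^ n / η * ∫ q : Q, ((c q : ℝ) - c qs) ∂(σA n : Measure Q) := by
      have hFA := (falseAlarmProb_ratioTest_le p qs.1 n ht.1).trans
        (pow_le_pow_left₀ hfpos.le hfa.le n)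
      have := integral_mono (μ := (σA n : Measure Q)) hIe
        ((integrable_const ((1 + γ) * a ^ n)).add (hIc.const_mul (ρ ^ n / η))) fun q => by
          simp only [classError, defenderUtility, Pi.add_apply, neg_neg]
          have h1 := hmiss n q
          have h2 := mul_le_mul_of_nonneg_left hFA hγ.le
          linarith
      simp only [Pi.add_apply] at this
      rw [integral_add (integrable_const _) (hIc.const_mul _),
        integral_const_mul (ρ ^ n / η) fun q : Q => (c q : ℝ) - c qs] at this
      simpa using this
    have hhalf : ρ ^ n / η ≤ 1 / 2 := by
      rw [div_le_iff₀ hη]; linarith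
    have han : a ^ n = Real.exp (n * (Real.log (ratioMGF p qs.1 t) + ε)) := by
      rw [ha, Real.exp_nat_mul]
    rw [← han]
    -- Absorption: `E ≤ (1 + γ) a ^ n + C / 2` and `C ≤ E` give the constant `2 (1 + γ)`.
    have hfin := mul_le_mul_of_nonneg_right hhalf hC0
    linarith
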